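/- A partition is a weakly decreasing tuple $\lambda=(\lambda_1,\dots,\lambda_n)$ of positive integers. The hook of a cell of its Young diagram consists of the cell, the cells to its right in its row and the cells below it in its column; the hook length is the number of cells in the hook. The partition is an $(s,t)$-core if no cell has hook length $s$ or $t$, and it has $d$-distinct parts if $\lambda_i-\lambda_{i+1}\ge d$ for $1\le i\le n-1$. We write $a \bmod b\in\{0,\dots,b-1\}$ for the remainder of $a$ on division by $b$. **Theorem.** Let $s,k,d$ be positive integers with $s\ge 2$ and $\gcd(s,k)=1$. Then the maximum $H_d(s,k)$ of the hook lengths of all cells of all $(s,s+k)$-cores with $d$-distinct parts exists. Put $\overline{s}=s\bmod k$, $$\widetilde{s}=\min\{\ell\cdot\overline{s}^{\,-1}\bmod k \;:\; \ell\in\mathbb{Z},\ -d\le\ell\le d,\ \ell\ne 0\},$$ where $\overline{s}^{\,-1}$ is the inverse of $\overline{s}$ modulo $k$, let $r=\overline{s}\,\widetilde{s}\bmod k$, and let $$B=\left\lfloor\frac{s-1}{k}\right\rfloor(k+s\widetilde{s})+s\left(\left\lceil\frac{\overline{s}\widetilde{s}-1}{k}\right\rceil+\widetilde{s}-1\right)+\overline{s}.$$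 Then $$H_d(s,k)=\begin{cases} s-1 & \text{if } k=1, \text{ or } k\le d \text{ and } s\le d,\\ s+k-1 & \text{if } 1<k\le d<s,\\ B-2 & \text{if } d<k \text{ and } r=1,\\ B-s-1 & \text{if } 1<r\le d<k,\\ B+k-r-1 & \text{if } d<r<k-1,\\ B-1 & \text{if } d<r=k-1, \end{cases}$$ and at least one of these cases always applies. -/

import Mathlib

namespace CoreHook

/-- The hook of the cell `c = (i, j)` (row `i`, column `j`, both from `0`) of a Young diagram:
the cells weakly to its right in its row and the cells weakly below it in its column. -/
def hook (μ : YoungDiagram) (c : ℕ × ℕ) : Finset (ℕ × ℕ) :=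
  μ.cells.filter (fun x => (x.1 = c.1 ∧ c.2 ≤ x.2) ∨ (x.2 = c.2 ∧ c.1 ≤ x.1))

/-- The hook length of a cell. -/
def hookLength (μ : YoungDiagram) (c : ℕ × ℕ) : ℕ := (hook μ c).card

/-- `μ` is an `s`-core: no cell has hook length `s`. -/
def IsCore (s : ℕ) (μ : YoungDiagram) : Prop := ∀ c ∈ μ, hookLength μ c ≠ s

/-- Consecutive (positive) parts differ by at least `d`. The parts are
`μ.rowLen 0 ≥ μ.rowLen 1 ≥ ⋯`, and their number is `μ.colLen 0`. -/
def IsDistinct (d : ℕ) (μ : YoungDiagram) : Prop :=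
  ∀ i : ℕ, i + 1 < μ.colLen 0 → μ.rowLen (i + 1) + d ≤ μ.rowLen i

/-- All hook lengths of cells of `d`-distinct `(s, t)`-cores. -/
def coreHookLengths (s t d : ℕ) : Set ℕ :=
  {h | ∃ μ : YoungDiagram, IsCore s μ ∧ IsCore t μ ∧ IsDistinct d μ ∧
    ∃ c ∈ μ, hookLength μ c = h}

/-- `s̄ = s mod k`. -/
def sBar (s k : ℕ) : ℕ := s % k

/-- `s̃ = min {ℓ · s̄⁻¹ mod k ∣ -d ≤ ℓ ≤ d, ℓ ≠ 0}`, the inverse being taken in `ℤ/kℤ` and the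
residue in `{0, …, k - 1}`; the set is nonempty when `d ≥ 1`. -/
noncomputable def sTilde (s k d : ℕ) : ℕ :=
  sInf {m : ℕ | ∃ l : ℤ, -(d : ℤ) ≤ l ∧ l ≤ (d : ℤ) ∧ l ≠ 0 ∧
    m = ((l : ZMod k) * ((sBar s k : ℕ) : ZMod k)⁻¹).val}

/-- The residue `s̄ s̃ mod k`. -/
noncomputable def sRes (s k d : ℕ) : ℕ := (sBar s k * sTilde s k d) % k

/-- `B = ⌊(s-1)/k⌋ (k + s s̃) + s (⌈(s̄ s̃ - 1)/k⌉ + s̃ - 1) + s̄`, with division in `ℚ`. -/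
noncomputable def bound (s k d : ℕ) : ℤ :=
  ⌊((s : ℚ) - 1) / (k : ℚ)⌋ * ((k : ℤ) + (s : ℤ) * (sTilde s k d : ℤ))
    + (s : ℤ) * (⌈((sBar s k : ℚ) * (sTilde s k d : ℚ) - 1) / (k : ℚ)⌉ + (sTilde s k d : ℤ) - 1)
    + (sBar s k : ℤ)

end CoreHook

namespace CoreHook

/-! Let S be the semigroup generated by s and s+k. A diagram is a core exactly when its beta-set X
(first-column hook lengths) is closed under subtracting s and s+k (`isCore_iff`). Let x be the
corner hook length, the largest of all. Then x - v lies in X for every v ≤ x in S. Since 0 ∉ X, x is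
a gap of S; since d-distinctness spaces X by more than d, x lies below the least M in S that exceeds
another element by at most d. Conversely, any gap H < M is attained by the beta-set {H - v}. So the
maximum is the largest gap below M (`isGreatest_coreHookLengths`): M - 1, or M - 2 if M - 1 is in S.
For d < k, finding M means finding the least A with As within d of a different multiple of k, which
is s̃; r tells on which side that multiple lies. -/

/-! ### Beta-sets, cores and distinctness -/

lemma hookLength_add (μ : YoungDiagram) {i j : ℕ} (h : (i, j) ∈ μ) :
    hookLength μ (i, j) + i + j + 1 = μ.rowLen i + μ.colLen j := by
  have hj : j < μ.rowLen i := YoungDiagram.mem_iff_lt_rowLen.1 h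
  have hi : i < μ.colLen j := YoungDiagram.mem_iff_lt_colLen.1 h
  have key : hook μ (i, j) =
      (Finset.Ico j (μ.rowLen i)).image (fun y => (i, y)) ∪
        (Finset.Ioo i (μ.colLen j)).image (fun x => (x, j)) := by
    ext ⟨x, y⟩
    simp only [hook, Finset.mem_filter, YoungDiagram.mem_cells, Finset.mem_union,
      Finset.mem_image, Finset.mem_Ico, Finset.mem_Ioo, Prod.mk.injEq]
    constructor
    · rintro ⟨hm, ⟨rfl, hy⟩ | ⟨rfl, hx⟩⟩
      · exact Or.inl ⟨y, ⟨hy, YoungDiagram.mem_iff_lt_rowLen.1 hm⟩, rfl, rfl⟩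
      · rcases hx.eq_or_lt with rfl | hx
        · exact Or.inl ⟨y, ⟨le_rfl, hj⟩, rfl, rfl⟩
        · exact Or.inr ⟨x, ⟨hx, YoungDiagram.mem_iff_lt_colLen.1 hm⟩, rfl, rfl⟩
    · rintro (⟨_, ⟨h1, h2⟩, rfl, rfl⟩ | ⟨_, ⟨h1, h2⟩, rfl, rfl⟩)
      · exact ⟨YoungDiagram.mem_iff_lt_rowLen.2 h2, Or.inl ⟨rfl, h1⟩⟩
      · exact ⟨YoungDiagram.mem_iff_lt_colLen.2 h2, Or.inr ⟨rfl, h1.le⟩⟩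
  have hdisj : Disjoint ((Finset.Ico j (μ.rowLen i)).image (fun y => (i, y)))
      ((Finset.Ioo i (μ.colLen j)).image (fun x => (x, j))) := by
    rw [Finset.disjoint_left]
    rintro ⟨x, y⟩ h1 h2
    simp only [Finset.mem_image, Finset.mem_Ico, Finset.mem_Ioo, Prod.mk.injEq] at h1 h2
    obtain ⟨_, _, rfl, _⟩ := h1
    obtain ⟨_, h3, rfl, _⟩ := h2
    omega
  rw [hookLength, key, Finset.card_union_of_disjoint hdisj,
    Finset.card_image_of_injective _ (fun a b hab => (Prod.mk.inj hab).2),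
    Finset.card_image_of_injective _ (fun a b hab => (Prod.mk.inj hab).1),
    Nat.card_Ico, Nat.card_Ioo]
  omega

/-- The set of hook lengths in the first column. -/
def betaSet (μ : YoungDiagram) : Set ℕ :=
  {x | ∃ i < μ.colLen 0, x + i + 1 = μ.rowLen i + μ.colLen 0}

lemma rowLen_pos_of_lt (μ : YoungDiagram) {i : ℕ} (h : i < μ.colLen 0) : 0 < μ.rowLen i :=
  YoungDiagram.mem_iff_lt_rowLen.1 (YoungDiagram.mem_iff_lt_colLen.2 h)

lemma zero_notMem_betaSet (μ : YoungDiagram) : 0 ∉ betaSet μ := by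
  rintro ⟨i, hi, h⟩
  have := rowLen_pos_of_lt μ hi
  omega

lemma lt_rowLen_iff_lt_colLen (μ : YoungDiagram) (i j : ℕ) :
    j < μ.rowLen i ↔ i < μ.colLen j :=
  YoungDiagram.mem_iff_lt_rowLen.symm.trans YoungDiagram.mem_iff_lt_colLen

lemma colLen_le (μ : YoungDiagram) (j : ℕ) : μ.colLen j ≤ μ.colLen 0 :=
  μ.colLen_anti 0 j (Nat.zero_le j)

/-- The naturals outside the beta-set are indexed by the columns. -/
lemma exists_column_of_notMem_betaSet (μ : YoungDiagram) {x : ℕ} (hx : x ∉ betaSet μ) :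
    ∃ j, x + μ.colLen j = j + μ.colLen 0 := by
  classical
  have hb : ∀ j, j + μ.colLen 0 ≤ x + μ.colLen j → j ≤ x := fun j hj => by
    have := colLen_le μ j
    omega
  let P : ℕ → Prop := fun j => j + μ.colLen 0 ≤ x + μ.colLen j
  have h0 : P 0 := by simp [P]
  have hj : P (Nat.findGreatest P x) := Nat.findGreatest_spec (Nat.zero_le x) h0
  have hj' : ¬ P (Nat.findGreatest P x + 1) := fun h => by
    have := Nat.le_findGreatest (hb _ h) h
    omega
  -- If equality failed for this last column j, row j + `μ.colLen 0` - x would have length exactly j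
  -- + 1, which puts x in the beta-set.
  generalize Nat.findGreatest P x = j at hj hj'
  simp only [P] at hj hj'
  refine ⟨j, ?_⟩
  by_contra hne
  have hle := colLen_le μ j
  refine hx ⟨j + μ.colLen 0 - x, by omega, ?_⟩
  have h1 := (lt_rowLen_iff_lt_colLen μ (j + μ.colLen 0 - x) j).2 (by omega)
  have h2 := mt (lt_rowLen_iff_lt_colLen μ (j + μ.colLen 0 - x) (j + 1)).1 (by omega)
  omega

lemma column_notMem_betaSet (μ : YoungDiagram) {x j : ℕ} (h : x + μ.colLen j = j + μ.colLen 0) :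
    x ∉ betaSet μ := by
  rintro ⟨m, hm, hx⟩
  have := lt_rowLen_iff_lt_colLen μ m j
  omega

/-- The hook length at (i, j) is the beta-number of row i minus the non-beta-number of column j. -/
lemma isCore_iff (μ : YoungDiagram) {s : ℕ} (hs : 1 ≤ s) :
    IsCore s μ ↔ ∀ x, x + s ∈ betaSet μ → x ∈ betaSet μ := by
  constructor
  · rintro hc x ⟨i, hi, h⟩
    by_contra hx
    obtain ⟨j, hj⟩ := exists_column_of_notMem_betaSet μ hx
    have hij := lt_rowLen_iff_lt_colLen μ i j
    have hmem : (i, j) ∈ μ := YoungDiagram.mem_iff_lt_rowLen.2 (by omega)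
    have := hookLength_add μ hmem
    exact hc _ hmem (by omega)
  · rintro hc ⟨i, j⟩ hmem heq
    have hl := hookLength_add μ hmem
    have h1 := YoungDiagram.mem_iff_lt_rowLen.1 hmem
    have h2 := YoungDiagram.mem_iff_lt_colLen.1 hmem
    have h3 := colLen_le μ j
    refine column_notMem_betaSet μ (x := j + μ.colLen 0 - μ.colLen j) (j := j) (by omega)
      (hc _ ⟨i, by omega, by omega⟩)

lemma rowLen_add_le (μ : YoungDiagram) {d : ℕ} (hμ : IsDistinct d μ) {i m : ℕ} (him : i < m)
    (hm : m < μ.colLen 0) : μ.rowLen m + d ≤ μ.rowLen i :=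
  (Nat.add_le_add_right (μ.rowLen_anti (i + 1) m him) d).trans (hμ i (by omega))

lemma betaSet_separated (μ : YoungDiagram) {d : ℕ} (hμ : IsDistinct d μ) {x y : ℕ}
    (hx : x ∈ betaSet μ) (hy : y ∈ betaSet μ) (hxy : x < y) : x + d < y := by
  obtain ⟨i, hi, h⟩ := hx
  obtain ⟨m, hm, h'⟩ := hy
  rcases lt_trichotomy i m with him | rfl | him
  · have := rowLen_add_le μ hμ him hm
    omega
  · omega
  · have := rowLen_add_le μ hμ him hi
    omega

/-! ### The semigroup and the upper bound -/

/-- The numerical semigroup generated by `s` and `t`. -/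
def semigroup (s t : ℕ) : Set ℕ := {v | ∃ a b : ℕ, v = a * s + b * t}

lemma zero_mem_semigroup (s t : ℕ) : 0 ∈ semigroup s t := ⟨0, 0, by simp⟩

lemma add_left_mem_semigroup {s t v : ℕ} (hv : v ∈ semigroup s t) : v + s ∈ semigroup s t := by
  obtain ⟨a, b, rfl⟩ := hv
  exact ⟨a + 1, b, by ring⟩

lemma add_right_mem_semigroup {s t v : ℕ} (hv : v ∈ semigroup s t) : v + t ∈ semigroup s t := by
  obtain ⟨a, b, rfl⟩ := hv
  exact ⟨a, b + 1, by ring⟩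

lemma mem_of_add_semigroup {s t : ℕ} {X : Set ℕ} (h1 : ∀ x, x + s ∈ X → x ∈ X)
    (h2 : ∀ x, x + t ∈ X → x ∈ X) {v : ℕ} (hv : v ∈ semigroup s t) {x : ℕ} (hx : x + v ∈ X) :
    x ∈ X := by
  obtain ⟨a, b, rfl⟩ := hv
  induction a with
  | zero =>
    induction b with
    | zero => simpa using hx
    | succ b ih => exact ih (h2 _ (by convert hx using 1; ring))
  | succ a ih => exact ih (h1 _ (by convert hx using 1; ring))

/-- The elements of the semigroup that exceed a smaller element by at most `d`. -/
def closeElements (s t d : ℕ) : Set ℕ :=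
  {v | v ∈ semigroup s t ∧ ∃ w ∈ semigroup s t, w < v ∧ v ≤ w + d}

lemma infinite_semigroup {s : ℕ} (t : ℕ) (hs : 1 ≤ s) : (semigroup s t).Infinite := by
  refine Set.infinite_of_injective_forall_mem (f := fun a : ℕ => a * s) ?_ fun a => ⟨a, 0, by simp⟩
  intro a b hab
  exact Nat.eq_of_mul_eq_mul_right hs hab

lemma hookLength_le_and_notMem {s t d M h : ℕ} (hs : 1 ≤ s) (ht : 1 ≤ t)
    (hM : M ∈ closeElements s t d) (hh : h ∈ coreHookLengths s t d) :
    ∃ x, h ≤ x ∧ x < M ∧ x ∉ semigroup s t := by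
  obtain ⟨μ, hcs, hct, hdist, ⟨i, j⟩, hc, rfl⟩ := hh
  have h1 := (isCore_iff μ hs).1 hcs
  have h2 := (isCore_iff μ ht).1 hct
  have hl := hookLength_add μ hc
  have hr := μ.rowLen_anti 0 i (Nat.zero_le i)
  have hcl := colLen_le μ j
  have hcol := YoungDiagram.mem_iff_lt_colLen.1 hc
  have hrow := YoungDiagram.mem_iff_lt_rowLen.1 hc
  have hx : μ.rowLen 0 + μ.colLen 0 - 1 ∈ betaSet μ := ⟨0, by omega, by omega⟩
  refine ⟨μ.rowLen 0 + μ.colLen 0 - 1, by omega, ?_, ?_⟩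
  · by_contra! hle
    obtain ⟨hMS, w, hw, hwM, hMw⟩ := hM
    generalize μ.rowLen 0 + μ.colLen 0 - 1 = x at *
    have e1 : x - M ∈ betaSet μ := mem_of_add_semigroup h1 h2 hMS (by rwa [Nat.sub_add_cancel hle])
    have e2 : x - w ∈ betaSet μ :=
      mem_of_add_semigroup h1 h2 hw (by rwa [Nat.sub_add_cancel (by omega)])
    have := betaSet_separated μ hdist e1 e2 (by omega)
    omega
  · intro hS
    exact zero_notMem_betaSet μ (mem_of_add_semigroup h1 h2 hS (by simpa using hx))

/-! ### Realising a gap as a hook length -/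

open Classical in
/-- The number of elements of the semigroup up to `H`. -/
noncomputable def numUpTo (s t H : ℕ) : ℕ := Nat.count (· ∈ semigroup s t) (H + 1)

/-- The `n`-th element of the semigroup, from `0`. -/
noncomputable def elt (s t n : ℕ) : ℕ := Nat.nth (· ∈ semigroup s t) n

lemma elt_strictMono {s : ℕ} (t : ℕ) (hs : 1 ≤ s) : StrictMono (elt s t) :=
  Nat.nth_strictMono (infinite_semigroup t hs)

lemma elt_mem {s : ℕ} (t : ℕ) (hs : 1 ≤ s) (n : ℕ) : elt s t n ∈ semigroup s t :=
  Nat.nth_mem_of_infinite (infinite_semigroup t hs) n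

lemma exists_elt_eq {s t v : ℕ} (hv : v ∈ semigroup s t) : ∃ n, elt s t n = v := by
  classical
  exact ⟨_, Nat.nth_count (p := (· ∈ semigroup s t)) hv⟩

lemma lt_numUpTo_iff {s : ℕ} (t : ℕ) (hs : 1 ≤ s) (H i : ℕ) :
    i < numUpTo s t H ↔ elt s t i ≤ H := by
  classical
  rw [numUpTo, elt, ← not_le,
    Nat.count_le_iff_le_nth (p := (· ∈ semigroup s t)) (infinite_semigroup t hs),
    Nat.succ_le_iff, not_lt]

lemma elt_add_le {s : ℕ} (t : ℕ) (hs : 1 ≤ s) {i m : ℕ} (h : i ≤ m) :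
    elt s t i + m ≤ elt s t m + i := by
  induction m, h using Nat.le_induction with
  | base => rfl
  | succ m _ ih =>
    have : elt s t m < elt s t (m + 1) := elt_strictMono t hs (Nat.lt_succ_self m)
    omega

/-- The diagram whose beta-set is `{H - v ∣ v ∈ semigroup s t, v ≤ H}`. -/
noncomputable def diagram {s : ℕ} (t : ℕ) (hs : 1 ≤ s) (H : ℕ) : YoungDiagram where
  cells := (Finset.range (numUpTo s t H) ×ˢ Finset.range (H + 1)).filter
    -- Row i has length its beta-number H - `elt s t i` minus the number of smaller beta-numbers,
    -- written without subtraction.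
    fun c => c.2 + numUpTo s t H + elt s t c.1 < H + c.1 + 1
  isLowerSet := by
    rintro ⟨i, j⟩ ⟨i', j'⟩ hle h
    simp only [Prod.mk_le_mk, Finset.coe_filter, Finset.mem_product, Finset.mem_range,
      Set.mem_ofPred_eq] at hle h ⊢
    have := elt_add_le t hs hle.1
    omega

lemma rowLen_diagram {s : ℕ} (t : ℕ) (hs : 1 ≤ s) {H i : ℕ} (hi : i < numUpTo s t H) :
    (diagram t hs H).rowLen i = H + i + 1 - (numUpTo s t H + elt s t i) := by
  refine eq_of_forall_lt_iff fun j => ?_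
  rw [← YoungDiagram.mem_iff_lt_rowLen, ← YoungDiagram.mem_cells]
  simp only [diagram, Finset.mem_filter, Finset.mem_product, Finset.mem_range]
  omega

/-- All rows are nonempty: H is a gap, so the last semigroup element counted is below H. -/
lemma elt_add_numUpTo_le {s : ℕ} (t : ℕ) (hs : 1 ≤ s) {H i : ℕ} (hH : H ∉ semigroup s t)
    (hi : i < numUpTo s t H) : numUpTo s t H + elt s t i < H + i + 1 := by
  have h1 := elt_add_le t hs (show i ≤ numUpTo s t H - 1 by omega)
  have h2 := (lt_numUpTo_iff t hs H (numUpTo s t H - 1)).1 (by omega)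
  have h3 : elt s t (numUpTo s t H - 1) ≠ H := fun h => hH (h ▸ elt_mem t hs _)
  omega

lemma colLen_diagram {s : ℕ} (t : ℕ) (hs : 1 ≤ s) {H : ℕ} (hH : H ∉ semigroup s t) :
    (diagram t hs H).colLen 0 = numUpTo s t H := by
  refine eq_of_forall_lt_iff fun i => ?_
  rw [← YoungDiagram.mem_iff_lt_colLen, ← YoungDiagram.mem_cells]
  simp only [diagram, Finset.mem_filter, Finset.mem_product, Finset.mem_range]
  have := elt_add_numUpTo_le t hs hH (i := i)
  omega

lemma mem_betaSet_diagram {s : ℕ} (t : ℕ) (hs : 1 ≤ s) {H : ℕ} (hH : H ∉ semigroup s t) (x : ℕ) :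
    x ∈ betaSet (diagram t hs H) ↔ ∃ v ∈ semigroup s t, x + v = H := by
  simp only [betaSet, colLen_diagram t hs hH, Set.mem_ofPred_eq]
  constructor
  · rintro ⟨i, hi, h⟩
    rw [rowLen_diagram t hs hi] at h
    have := elt_add_numUpTo_le t hs hH hi
    exact ⟨_, elt_mem t hs i, by omega⟩
  · rintro ⟨v, hv, h⟩
    obtain ⟨i, rfl⟩ := exists_elt_eq hv
    have hi := (lt_numUpTo_iff t hs H i).2 (by omega)
    have := elt_add_numUpTo_le t hs hH hi
    exact ⟨i, hi, by rw [rowLen_diagram t hs hi]; omega⟩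

lemma mem_coreHookLengths {s t d H : ℕ} (hs : 1 ≤ s) (ht : 1 ≤ t) (hH : H ∉ semigroup s t)
    (hgap : ∀ v ∈ closeElements s t d, H < v) : H ∈ coreHookLengths s t d := by
  have hpos : 0 < numUpTo s t H := by
    obtain ⟨i, hi⟩ := exists_elt_eq (zero_mem_semigroup s t)
    have := (lt_numUpTo_iff t hs H i).2 (by omega)
    omega
  have helt : elt s t 0 = 0 := by
    obtain ⟨i, hi⟩ := exists_elt_eq (zero_mem_semigroup s t)
    have := (elt_strictMono t hs).monotone (Nat.zero_le i)
    omega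
  have h0 := elt_add_numUpTo_le t hs hH hpos
  have hcol := colLen_diagram t hs hH
  have hrow := rowLen_diagram t hs hpos
  have hmem : (0, 0) ∈ diagram t hs H := YoungDiagram.mem_iff_lt_rowLen.2 (by omega)
  refine ⟨diagram t hs H, (isCore_iff _ hs).2 fun x => ?_, (isCore_iff _ ht).2 fun x => ?_,
    fun i hi => ?_, (0, 0), hmem, ?_⟩
  · simp only [mem_betaSet_diagram t hs hH]
    rintro ⟨v, hv, h⟩
    exact ⟨v + s, add_left_mem_semigroup hv, by omega⟩
  · simp only [mem_betaSet_diagram t hs hH]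
    rintro ⟨v, hv, h⟩
    exact ⟨v + t, add_right_mem_semigroup hv, by omega⟩
  · rw [hcol] at hi
    rw [rowLen_diagram t hs hi, rowLen_diagram t hs (by omega)]
    have h1 := elt_add_numUpTo_le t hs hH hi
    have h2 : elt s t i < elt s t (i + 1) := elt_strictMono t hs (Nat.lt_succ_self i)
    have h3 := (lt_numUpTo_iff t hs H (i + 1)).1 hi
    have h4 : ¬ elt s t (i + 1) ≤ elt s t i + d := fun h =>
      absurd (hgap _ ⟨elt_mem t hs _, _, elt_mem t hs i, h2, h⟩) (by omega)
    omega
  · have := hookLength_add _ hmem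
    omega

/-! ### Reduction to the least close element -/

/-- The largest hook length is the largest gap of the semigroup below the least close element. -/
lemma isGreatest_coreHookLengths {s t d M H : ℕ} (hs : 1 ≤ s) (ht : 1 ≤ t)
    (hM : IsLeast (closeElements s t d) M) (hH : H ∉ semigroup s t) (hHM : H < M)
    (hmax : ∀ x, H < x → x < M → x ∈ semigroup s t) :
    IsGreatest (coreHookLengths s t d) H := by
  refine ⟨mem_coreHookLengths hs ht hH fun v hv => hHM.trans_le (hM.2 hv), fun h hh => ?_⟩
  obtain ⟨x, hhx, hxM, hx⟩ := hookLength_le_and_notMem hs ht hM.1 hh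
  by_contra! hlt
  exact hx (hmax x (by omega) hxM)

/-- If the least close element is at distance at least two from a semigroup element close to it,
its predecessor is the largest hook length. -/
lemma isGreatest_pred {s t d M w : ℕ} (hs : 1 ≤ s) (ht : 1 ≤ t)
    (hM : IsLeast (closeElements s t d) M) (hw : w ∈ semigroup s t) (hwM : w + 1 < M)
    (hMw : M ≤ w + d) : IsGreatest (coreHookLengths s t d) (M - 1) := by
  refine isGreatest_coreHookLengths hs ht hM (fun h => ?_) (by omega) fun x _ _ => by omega
  have := hM.2 ⟨h, w, hw, by omega, by omega⟩
  omega

/-- If the predecessor of the least close element is in the semigroup, the number before that is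
the largest hook length. -/
lemma isGreatest_pred_pred {s t d w : ℕ} (hs : 2 ≤ s) (ht : 2 ≤ t) (hd : 1 ≤ d)
    (hM : IsLeast (closeElements s t d) (w + 1)) (hw : w ∈ semigroup s t) :
    1 ≤ w ∧ IsGreatest (coreHookLengths s t d) (w - 1) := by
  have hw1 : w ≠ 0 := by
    rintro rfl
    obtain ⟨a, b, h⟩ := hM.1.1
    rcases Nat.eq_zero_or_pos a with rfl | ha
    · rcases Nat.eq_zero_or_pos b with rfl | hb
      · omega
      · nlinarith
    · nlinarith [Nat.zero_le (b * t)]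
  refine ⟨by omega, isGreatest_coreHookLengths (by omega) (by omega) hM (fun h => ?_) (by omega)
    fun x h1 h2 => ?_⟩
  · have := hM.2 ⟨hw, w - 1, h, by omega, by omega⟩
    omega
  · rwa [show x = w by omega]


/-! ### The least close element when d < k -/

/-- Two elements of `⟨s, s + k⟩` at distance in `1, …, d` lie above two such elements of the form
`(A + B) s` and `B (s + k)`. -/
lemma exists_of_mem_closeElements {s k d v : ℕ} (hdk : d < k)
    (hv : v ∈ closeElements s (s + k) d) :
    ∃ A B : ℕ, 1 ≤ A ∧
      ((B * k < A * s ∧ A * s ≤ B * k + d ∧ (A + B) * s ≤ v) ∨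
        (A * s < B * k ∧ B * k ≤ A * s + d ∧ B * (s + k) ≤ v)) := by
  obtain ⟨⟨a, b, rfl⟩, w, ⟨a', b', rfl⟩, h1, h2⟩ := hv
  -- In v = (a + b)s + bk, A and B are the absolute differences of the coefficients of s and k.
  -- Equal a + b would force a difference of at least k > d.
  rcases lt_trichotomy (a + b) (a' + b') with hn | hn | hn
  · obtain ⟨A, hA⟩ := Nat.exists_eq_add_of_lt hn
    have hA' : (a' + b') * s = (a + b + A + 1) * s := by rw [hA]
    have hb : b' < b := by
      by_contra! hb
      have := Nat.mul_le_mul_right k hb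
      nlinarith
    obtain ⟨B, rfl⟩ := Nat.exists_eq_add_of_lt hb
    exact ⟨A + 1, B + 1, by omega, Or.inr ⟨by nlinarith, by nlinarith, by nlinarith⟩⟩
  · have hA' : (a + b) * s = (a' + b') * s := by rw [hn]
    have hb : b' < b := by
      by_contra! hb
      have := Nat.mul_le_mul_right k hb
      nlinarith
    obtain ⟨B, rfl⟩ := Nat.exists_eq_add_of_lt hb
    nlinarith [Nat.zero_le (B * k)]
  · obtain ⟨A, hA⟩ := Nat.exists_eq_add_of_lt hn
    have hA' : (a + b) * s = (a' + b' + A + 1) * s := by rw [hA]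
    have hb : b ≤ b' := by
      by_contra! hb
      have := Nat.mul_le_mul_right k (Nat.succ_le_of_lt hb)
      nlinarith [Nat.zero_le (A * s), Nat.zero_le s]
    obtain ⟨B, rfl⟩ := Nat.exists_eq_add_of_le hb
    refine ⟨A + 1, B, by omega, Or.inl ⟨by nlinarith, by nlinarith, ?_⟩⟩
    nlinarith [Nat.zero_le (a' * s), Nat.zero_le (b * s), Nat.zero_le (b * k)]

/-- `A s` is at distance in `1, …, d` from a multiple of `k`. -/
def IsNear (s k d A : ℕ) : Prop :=
  ∃ B : ℕ, (B * k < A * s ∧ A * s ≤ B * k + d) ∨ (A * s < B * k ∧ B * k ≤ A * s + d)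

lemma sBar_cast (s k : ℕ) : ((sBar s k : ℕ) : ZMod k) = s := by simp [sBar]

/-- As ≡ l mod k makes l·s̄⁻¹ mod k the residue of A, which is at most A. -/
lemma sTilde_le {s k d A : ℕ} (hk : 1 ≤ k) (hsk : Nat.Coprime s k) (hA : IsNear s k d A) :
    sTilde s k d ≤ A := by
  have : NeZero k := ⟨by omega⟩
  have key : ∀ l : ℤ, -(d : ℤ) ≤ l → l ≤ d → l ≠ 0 → (k : ℤ) ∣ A * s - l → sTilde s k d ≤ A := by
    intro l h1 h2 h3 h4
    have hle : sTilde s k d ≤ ((l : ZMod k) * ((sBar s k : ℕ) : ZMod k)⁻¹).val :=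
      Nat.sInf_le ⟨l, h1, h2, h3, rfl⟩
    refine hle.trans ?_
    have h5 : ((A * s : ℤ) : ZMod k) = (l : ZMod k) := by
      rw [← sub_eq_zero, ← Int.cast_sub]
      exact (ZMod.intCast_zmod_eq_zero_iff_dvd _ k).2 h4
    push_cast at h5
    rw [sBar_cast, ← h5, mul_assoc, ZMod.coe_mul_inv_eq_one s hsk, mul_one, ZMod.val_natCast]
    exact Nat.mod_le _ _
  obtain ⟨B, ⟨h1, h2⟩ | ⟨h1, h2⟩⟩ := hA
  · exact key (A * s - B * k) (by zify at h1 h2; linarith) (by zify at h1 h2; linarith)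
      (by zify at h1 h2; linarith) ⟨B, by ring⟩
  · exact key (A * s - B * k) (by zify at h1 h2; linarith) (by zify at h1 h2; linarith)
      (by zify at h1 h2; linarith) ⟨B, by ring⟩

lemma isNear_sTilde {s k d : ℕ} (hd : 1 ≤ d) (hdk : d < k) (hsk : Nat.Coprime s k) :
    IsNear s k d (sTilde s k d) := by
  have : NeZero k := ⟨by omega⟩
  obtain ⟨l, h1, h2, h3, hm⟩ : sTilde s k d ∈ {m : ℕ | ∃ l : ℤ, -(d : ℤ) ≤ l ∧ l ≤ (d : ℤ) ∧
      l ≠ 0 ∧ m = ((l : ZMod k) * ((sBar s k : ℕ) : ZMod k)⁻¹).val} :=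
    Nat.sInf_mem ⟨_, 1, by omega, by omega, one_ne_zero, rfl⟩
  generalize sTilde s k d = A at hm
  have h4 : ((A * s - l : ℤ) : ZMod k) = 0 := by
    rw [hm, sBar_cast]
    push_cast
    rw [ZMod.natCast_zmod_val, mul_assoc, mul_comm _ (s : ZMod k), ZMod.coe_mul_inv_eq_one s hsk,
      mul_one, sub_self]
  obtain ⟨c, hc⟩ := (ZMod.intCast_zmod_eq_zero_iff_dvd _ k).1 h4
  -- A negative quotient would force l ≥ k > d.
  have hc0 : 0 ≤ c := by
    by_contra! hneg
    have : (k : ℤ) * c ≤ k * (-1) := mul_le_mul_of_nonneg_left (by omega) (by omega)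
    have : (0 : ℤ) ≤ A * s := by positivity
    omega
  lift c to ℕ using hc0
  refine ⟨c, ?_⟩
  zify
  rw [mul_comm (c : ℤ)]
  generalize (A : ℤ) * s = x at *
  generalize (k : ℤ) * c = y at *
  omega

lemma sTilde_pos {s k d : ℕ} (hd : 1 ≤ d) (hdk : d < k) (hsk : Nat.Coprime s k) :
    1 ≤ sTilde s k d := by
  by_contra! h
  obtain ⟨B, hB⟩ := isNear_sTilde hd hdk hsk
  rw [Nat.lt_one_iff.1 h] at hB
  rcases Nat.eq_zero_or_pos B with rfl | hB0
  · omega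
  · have := Nat.mul_le_mul_right k hB0
    omega

lemma sRes_eq (s k d : ℕ) : sRes s k d = sTilde s k d * s % k := by
  rw [sRes, sBar, Nat.mod_mul_mod, mul_comm]

lemma sRes_pos_and {s k d : ℕ} (hd : 1 ≤ d) (hdk : d < k) (hsk : Nat.Coprime s k) :
    1 ≤ sRes s k d ∧ (d < sRes s k d → k ≤ sRes s k d + d) := by
  rw [sRes_eq]
  obtain ⟨B, hB⟩ := isNear_sTilde hd hdk hsk
  generalize sTilde s k d * s = x at hB
  have hx := Nat.div_add_mod' x k
  have hr := Nat.mod_lt x (show 0 < k by omega)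
  generalize x / k = q at hx
  generalize x % k = r at hx hr ⊢
  rcases lt_trichotomy q B with h | rfl | h
  · have h1 := Nat.mul_le_mul_right k (Nat.add_one_le_iff.2 h)
    have h2 : (q + 1) * k = q * k + k := by ring
    omega
  · omega
  · have h1 := Nat.mul_le_mul_right k (Nat.add_one_le_iff.2 h)
    have h2 : (B + 1) * k = B * k + k := by ring
    omega

/-- As r ≥ 1, k does not divide s, so the floor is ⌊s/k⌋; the ceiling is ⌊s̄s̃/k⌋, plus one unless r
= 1. The terms k⌊s/k⌋ + s̄ = s cancel the -1. -/
lemma bound_eq {s k d : ℕ} (hd : 1 ≤ d) (hdk : d < k) (hsk : Nat.Coprime s k) :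
    bound s k d = s * (sTilde s k d + (sTilde s k d * s / k : ℕ)
      + if sRes s k d = 1 then 0 else 1) := by
  have hk : 0 < k := by omega
  have hkQ : (0 : ℚ) < k := by exact_mod_cast hk
  have hr0 := (sRes_pos_and hd hdk hsk).1
  have hs0 : 0 < s % k := by
    rcases Nat.eq_zero_or_pos (s % k) with h | h
    · rw [sRes, sBar, h] at hr0
      simp at hr0
    · exact h
  have hsl := Nat.mod_lt s hk
  have hsq := Nat.div_add_mod s k
  have hrl : sRes s k d < k := Nat.mod_lt _ hk
  have hc := Nat.div_add_mod (s % k * sTilde s k d) k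
  change k * _ + sRes s k d = _ at hc
  have hdiv : sTilde s k d * s / k = s / k * sTilde s k d + s % k * sTilde s k d / k := by
    rw [← Nat.mul_add_div hk, ← mul_assoc k, ← add_mul, hsq, mul_comm]
  have hfl : ⌊((s : ℚ) - 1) / (k : ℚ)⌋ = ((s / k : ℕ) : ℤ) := by
    rw [Int.floor_eq_iff, le_div_iff₀ hkQ, div_lt_iff₀ hkQ]
    have e : (s : ℚ) = k * (s / k : ℕ) + (s % k : ℕ) := by exact_mod_cast hsq.symm
    have e1 : (1 : ℚ) ≤ (s % k : ℕ) := by exact_mod_cast hs0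
    have e2 : ((s % k : ℕ) : ℚ) < k := by exact_mod_cast hsl
    rw [e, Int.cast_natCast]
    constructor <;> linarith
  have hce : ⌈((sBar s k : ℚ) * (sTilde s k d : ℚ) - 1) / (k : ℚ)⌉ =
      ((s % k * sTilde s k d / k : ℕ) : ℤ) + if sRes s k d = 1 then 0 else 1 := by
    rw [Int.ceil_eq_iff, lt_div_iff₀ hkQ, div_le_iff₀ hkQ, sBar]
    have e : ((s % k : ℕ) : ℚ) * (sTilde s k d : ℚ) =
        k * (s % k * sTilde s k d / k : ℕ) + sRes s k d := by exact_mod_cast hc.symm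
    rw [e]
    have e2 : (sRes s k d : ℚ) < k := by exact_mod_cast hrl
    generalize s % k * sTilde s k d / k = c
    split_ifs with h
    · rw [h]
      push_cast
      constructor <;> linarith
    · have e1 : (2 : ℚ) ≤ sRes s k d := by exact_mod_cast (show 2 ≤ sRes s k d by omega)
      push_cast
      constructor <;> linarith
  rw [bound, hfl, hce, hdiv, sBar]
  have e : (s : ℤ) = k * (s / k : ℕ) + (s % k : ℕ) := by exact_mod_cast hsq.symm
  push_cast at e ⊢
  linear_combination (-1 : ℤ) * e

/-- With a = s̃ and b = ⌊as/k⌋, (a + b)s exceeds b(s + k) by r. Any competing pair has A ≥ a, hence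
B ≥ b since As is within d < k of Bk. -/
lemma isLeast_closeElements_of_le {s k d : ℕ} (hd : 1 ≤ d) (hdk : d < k) (hsk : Nat.Coprime s k)
    (hr : sRes s k d ≤ d) :
    IsLeast (closeElements s (s + k) d) ((sTilde s k d + sTilde s k d * s / k) * s) := by
  have hr0 := (sRes_pos_and hd hdk hsk).1
  have hle := fun A => sTilde_le (s := s) (d := d) (A := A) (by omega) hsk
  rw [sRes_eq] at hr hr0
  generalize sTilde s k d = a at *
  have hx := Nat.div_add_mod' (a * s) k
  generalize a * s / k = b at *
  generalize a * s % k = r at *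
  constructor
  · exact ⟨⟨a + b, 0, by ring⟩, b * (s + k), ⟨0, b, by ring⟩, by nlinarith, by nlinarith⟩
  · intro v hv
    obtain ⟨A, B, hA, h⟩ := exists_of_mem_closeElements hdk hv
    have haA : a ≤ A := hle A ⟨B, by tauto⟩
    have hs := Nat.mul_le_mul_right s haA
    have hbB : b ≤ B := by
      by_contra! hlt
      have := Nat.mul_le_mul_right k (Nat.succ_le_of_lt hlt)
      rcases h with h | h <;> nlinarith
    have h3 : (a + b) * s ≤ (A + B) * s := Nat.mul_le_mul_right s (by omega)
    rcases h with h | h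
    · exact h3.trans h.2.2
    · nlinarith

/-- Now the near multiple is (b + 1)k, above as: (b + 1)(s + k) exceeds (a + b + 1)s by k - r ≤ d.
-/
lemma isLeast_closeElements_of_lt {s k d : ℕ} (hd : 1 ≤ d) (hdk : d < k) (hsk : Nat.Coprime s k)
    (hr : d < sRes s k d) :
    IsLeast (closeElements s (s + k) d) ((sTilde s k d * s / k + 1) * (s + k)) := by
  have hr0 := (sRes_pos_and hd hdk hsk).2 hr
  have hle := fun A => sTilde_le (s := s) (d := d) (A := A) (by omega) hsk
  rw [sRes_eq] at hr hr0
  generalize sTilde s k d = a at *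
  have hx := Nat.div_add_mod' (a * s) k
  have hrk := Nat.mod_lt (a * s) (show 0 < k by omega)
  generalize a * s / k = b at *
  generalize a * s % k = r at *
  constructor
  · exact ⟨⟨0, b + 1, by ring⟩, (a + b + 1) * s, ⟨a + b + 1, 0, by ring⟩,
      by nlinarith, by nlinarith⟩
  · intro v hv
    obtain ⟨A, B, hA, h⟩ := exists_of_mem_closeElements hdk hv
    have haA : a ≤ A := hle A ⟨B, by tauto⟩
    have hs := Nat.mul_le_mul_right s haA
    have hbB : b + 1 ≤ B := by
      by_contra! hlt
      have := Nat.mul_le_mul_right k (Nat.le_of_lt_succ hlt)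
      rcases h with h | h <;> omega
    have h3 : (b + 1) * (s + k) ≤ B * (s + k) := Nat.mul_le_mul_right _ hbB
    rcases h with h | h
    · nlinarith
    · exact h3.trans h.2.2

/-! ### The least close element when k ≤ d -/

lemma eq_zero_or_le_of_mem_semigroup {s k v : ℕ} (hv : v ∈ semigroup s (s + k)) :
    v = 0 ∨ v = s ∨ s + k ≤ v ∨ 2 * s ≤ v := by
  obtain ⟨a, b, rfl⟩ := hv
  rcases b with _ | b
  · rcases a with _ | _ | a
    · simp
    · simp
    · refine Or.inr (Or.inr (Or.inr ?_))
      nlinarith [Nat.zero_le (a * s)]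
  · refine Or.inr (Or.inr (Or.inl ?_))
    nlinarith [Nat.zero_le (b * (s + k)), Nat.zero_le (a * s)]

lemma left_mem_semigroup (s t : ℕ) : s ∈ semigroup s t := ⟨1, 0, by simp⟩

lemma right_mem_semigroup (s t : ℕ) : t ∈ semigroup s t := ⟨0, 1, by simp⟩

lemma isLeast_closeElements_left {s k d : ℕ} (hs : 1 ≤ s) (hsd : s ≤ d) :
    IsLeast (closeElements s (s + k) d) s := by
  refine ⟨⟨left_mem_semigroup _ _, 0, zero_mem_semigroup _ _, by omega, by omega⟩, ?_⟩
  rintro v ⟨hv, w, _, h1, _⟩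
  have := eq_zero_or_le_of_mem_semigroup hv
  omega

lemma isLeast_closeElements_right {s k d : ℕ} (hk : 1 ≤ k) (hkd : k ≤ d) (hds : d < s) :
    IsLeast (closeElements s (s + k) d) (s + k) := by
  refine ⟨⟨right_mem_semigroup _ _, s, left_mem_semigroup _ _, by omega, by omega⟩, ?_⟩
  rintro v ⟨hv, w, hw, h1, h2⟩
  have := eq_zero_or_le_of_mem_semigroup hv
  have := eq_zero_or_le_of_mem_semigroup hw
  omega

end CoreHook

/-! ### Assembling the six cases -/

theorem theorem1p1 (s k d : ℕ) (hs : 2 ≤ s) (hk : 1 ≤ k) (hd : 1 ≤ d) (hsk : Nat.Coprime s k) :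
    ∃ H : ℕ, IsGreatest (CoreHook.coreHookLengths s (s + k) d) H ∧
      ((k = 1 ∨ (k ≤ d ∧ s ≤ d)) → (H : ℤ) = (s : ℤ) - 1) ∧
      ((1 < k ∧ k ≤ d ∧ d < s) → (H : ℤ) = (s : ℤ) + (k : ℤ) - 1) ∧
      ((d < k ∧ CoreHook.sRes s k d = 1) → (H : ℤ) = CoreHook.bound s k d - 2) ∧
      ((1 < CoreHook.sRes s k d ∧ CoreHook.sRes s k d ≤ d ∧ d < k) →
        (H : ℤ) = CoreHook.bound s k d - (s : ℤ) - 1) ∧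
      ((d < CoreHook.sRes s k d ∧ CoreHook.sRes s k d < k - 1) →
        (H : ℤ) = CoreHook.bound s k d + (k : ℤ) - (CoreHook.sRes s k d : ℤ) - 1) ∧
      ((d < CoreHook.sRes s k d ∧ CoreHook.sRes s k d = k - 1) →
        (H : ℤ) = CoreHook.bound s k d - 1) ∧
      -- the six cases are exhaustive
      ((k = 1 ∨ (k ≤ d ∧ s ≤ d)) ∨
        (1 < k ∧ k ≤ d ∧ d < s) ∨
        (d < k ∧ CoreHook.sRes s k d = 1) ∨
        (1 < CoreHook.sRes s k d ∧ CoreHook.sRes s k d ≤ d ∧ d < k) ∨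
        (d < CoreHook.sRes s k d ∧ CoreHook.sRes s k d < k - 1) ∨
        (d < CoreHook.sRes s k d ∧ CoreHook.sRes s k d = k - 1)) := by
  have hs1 : 1 ≤ s := by omega
  have ht1 : 1 ≤ s + k := by omega
  rcases le_or_gt k d with hkd | hdk
  · have hrk : CoreHook.sRes s k d < k := Nat.mod_lt _ (by omega)
    rcases le_or_gt s d with hsd | hds
    · refine ⟨s - 1, CoreHook.isGreatest_pred hs1 ht1 (CoreHook.isLeast_closeElements_left hs1 hsd)
        (CoreHook.zero_mem_semigroup _ _) (by omega) (by omega), ?_⟩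
      omega
    · have hM := CoreHook.isLeast_closeElements_right hk hkd hds
      rcases hk.eq_or_lt with rfl | hk1
      · have := CoreHook.isGreatest_pred_pred hs (by omega) hd hM (CoreHook.left_mem_semigroup _ _)
        refine ⟨s - 1, this.2, ?_⟩
        omega
      · refine ⟨s + k - 1, CoreHook.isGreatest_pred hs1 ht1 hM
          (CoreHook.left_mem_semigroup _ _) (by omega) (by omega), ?_⟩
        omega
  · have hrk : CoreHook.sRes s k d < k := Nat.mod_lt _ (by omega)
    have hB := CoreHook.bound_eq hd hdk hsk
    obtain ⟨hr0, hr1⟩ := CoreHook.sRes_pos_and hd hdk hsk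
    have hre := CoreHook.sRes_eq s k d
    have hx := Nat.div_add_mod' (CoreHook.sTilde s k d * s) k
    rw [← hre] at hx
    rcases le_or_gt (CoreHook.sRes s k d) d with hr | hr
    · have hM := CoreHook.isLeast_closeElements_of_le hd hdk hsk hr
      have hpos := CoreHook.sTilde_pos hd hdk hsk
      generalize CoreHook.sTilde s k d = a at *
      generalize a * s / k = b at *
      have hw : b * (s + k) ∈ CoreHook.semigroup s (s + k) := ⟨0, b, by ring⟩
      have hMw : (a + b) * s = b * (s + k) + CoreHook.sRes s k d := by nlinarith
      have hMz : ((b * (s + k) + CoreHook.sRes s k d : ℕ) : ℤ) = s * (a + b) := by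
        rw [← hMw]
        push_cast
        ring
      rw [hMw] at hM
      rcases hr0.eq_or_lt with hr2 | hr2
      · rw [← hr2] at hM
        obtain ⟨hw1, hG⟩ := CoreHook.isGreatest_pred_pred hs (by omega) hd hM hw
        rw [if_pos hr2.symm, add_zero] at hB
        refine ⟨_, hG, ?_⟩
        omega
      · have hG := CoreHook.isGreatest_pred hs1 ht1 hM hw (by omega) (by omega)
        rw [if_neg (by omega), mul_add, mul_one] at hB
        refine ⟨_, hG, ?_⟩
        omega
    · have hM := CoreHook.isLeast_closeElements_of_lt hd hdk hsk hr
      generalize CoreHook.sTilde s k d = a at *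
      generalize a * s / k = b at *
      have hw : (a + b + 1) * s ∈ CoreHook.semigroup s (s + k) := ⟨a + b + 1, 0, by ring⟩
      have hMw : (b + 1) * (s + k) + CoreHook.sRes s k d = (a + b + 1) * s + k := by nlinarith
      have hwz : (((a + b + 1) * s : ℕ) : ℤ) = s * (a + b + 1) := by
        push_cast
        ring
      rw [if_neg (by omega)] at hB
      generalize (b + 1) * (s + k) = m at *
      generalize (a + b + 1) * s = w at *
      rcases (show CoreHook.sRes s k d ≤ k - 1 by omega).eq_or_lt with hr2 | hr2
      · obtain rfl : m = w + 1 := by omega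
        obtain ⟨hw1, hG⟩ := CoreHook.isGreatest_pred_pred hs (by omega) hd hM hw
        refine ⟨_, hG, ?_⟩
        omega
      · have hG := CoreHook.isGreatest_pred hs1 ht1 hM hw (by omega) (by omega)
        refine ⟨_, hG, ?_⟩
        omega
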